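/- Let $\mathcal H$ be a complex Hilbert space and $S$ a densely defined symmetric operator in $\mathcal H$ with closure $\overline S$ and adjoint $S^*$. Assume that $0$ is a point of regular type of $\overline S$, i.e. there is $c>0$ with $\|\overline S f\|\ge c\|f\|$ for all $f\in\mathcal D(\overline S)$, and that $\ker S^*\neq\{0\}$. Let $S_{\mathrm D}$ be a self-adjoint extension of $S$ with everywhere defined bounded inverse $S_{\mathrm D}^{-1}$, and let $\widetilde S$ be a self-adjoint extension of $S$. Let $P_W$ denote the orthogonal projection onto a closed subspace $W$. For every $\varepsilon>0$ there is a unique unitary $U_\varepsilon:\ker(S^*-\mathrm i\varepsilon)\to\ker(S^*+\mathrm i\varepsilon)$ such that $$\mathcal D(\widetilde S)=\{f_\varepsilon+u_\varepsilon-U_\varepsilon u_\varepsilon \mid f_\varepsilon\in\mathcal D(\overline S),\ u_\varepsilon\in\ker(S^*-\mathrm i\varepsilon)\},\qquad \widetilde S(f_\varepsilon+u_\varepsilon-U_\varepsilon u_\varepsilon)=\overline S f_\varepsilon+\mathrm i\varepsilon u_\varepsilon+\mathrm i\varepsilon U_\varepsilon u_\varepsilon ,$$ and there is a unique operator $T$,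 self-adjoint in some closed subspace of $\ker S^*$, such that $$\mathcal D(\widetilde S)=\{f+S_{\mathrm D}^{-1}(Tu+w)+u \mid f\in\mathcal D(\overline S),\ u\in\mathcal D(T),\ w\in\ker S^*\cap\mathcal D(T)^\perp\},\qquad \widetilde S(f+S_{\mathrm D}^{-1}(Tu+w)+u)=\overline S f+Tu+w .$$ Every $g\in\mathcal D(\widetilde S)$ can be written as $$f+S_{\mathrm D}^{-1}(Tu+w)+u=g=f_\varepsilon+u_\varepsilon-U_\varepsilon u_\varepsilon\qquad(\varepsilon>0)$$ with components $f,f_\varepsilon\in\mathcal D(\overline S)$, $u\in\mathcal D(T)$, $w\in\ker S^*\cap\mathcal D(T)^\perp$, $u_\varepsilon\in\ker(S^*-\mathrm i\varepsilon)$ in the above spaces, which are uniquely determined by $g$, and \begin{align*} u_\varepsilon&=(2\mathrm i\varepsilon)^{-1}P_{\ker(S^*-\mathrm i\varepsilon)}(\widetilde S+\mathrm i\varepsilon)g, & U_\varepsilon u_\varepsilon&=(2\mathrm i\varepsilon)^{-1}P_{\ker(S^*+\mathrm i\varepsilon)}(\widetilde S-\mathrm i\varepsilon)g,\\ u&=(1-S_{\mathrm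 D}^{-1}\widetilde S)g, & f&=S_{\mathrm D}^{-1}(1-P_{\ker S^*})\widetilde S g,\\ Tu+w&=P_{\ker S^*}\widetilde S g . \end{align*} Moreover, for each fixed $g$, as $\varepsilon\downarrow0$, in the norm of $\mathcal H$, \begin{align*} (1-S_{\mathrm D}^{-1}S^*)(u_\varepsilon-U_\varepsilon u_\varepsilon)&=u+O(\varepsilon),\\ 2\mathrm i\varepsilon u_\varepsilon&=Tu+w+O(\varepsilon),\\ 2\mathrm i\varepsilon U_\varepsilon u_\varepsilon&=Tu+w+O(\varepsilon),\\ u_\varepsilon-U_\varepsilon u_\varepsilon&=S_{\mathrm D}^{-1}(Tu+w)+u+O(\varepsilon),\\ \mathrm i\varepsilon u_\varepsilon+\mathrm i\varepsilon U_\varepsilon u_\varepsilon&=Tu+w+O(\varepsilon),\\ f_\varepsilon&=f+O(\varepsilon),\\ \overline S f_\varepsilon&=\overline S f+O(\varepsilon). \end{align*} Finally, $u_\varepsilon-U_\varepsilon u_\varepsilon=S_{\mathrm D}^{-1}(Tu+w)+u+O(\varepsilon)$ and $f_\varepsilon=f+O(\varepsilon)$ hold also in the graph norm $(\|x\|^2+\|\widetilde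 S x\|^2)^{1/2}$ of $\widetilde S$ (all vectors involved belonging to $\mathcal D(\widetilde S)$), and likewise in the graph norm of $S^*$. -/

import Mathlib

open scoped LinearPMap Topology
open Filter Asymptotics

noncomputable section

namespace ExtensionTheory

variable {H : Type*} [NormedAddCommGroup H] [InnerProductSpace ℂ H]

/-- `z` is a point of regular type of `A`: the operator `A - z` is injective with bounded inverse,
the inverse being defined on the range of `A - z`. -/
def IsRegularTypePoint (A : H →ₗ.[ℂ] H) (z : ℂ) : Prop :=
  ∃ c : ℝ, 0 < c ∧ ∀ f : A.domain, c * ‖(f : H)‖ ≤ ‖A f - z • (f : H)‖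

/-- `R` is the everywhere defined bounded inverse of `A`. -/
def IsBoundedInverse (A : H →ₗ.[ℂ] H) (R : H →L[ℂ] H) : Prop :=
  (∀ x : A.domain, R (A x) = x) ∧ ∀ y : H, ∃ h : R y ∈ A.domain, A ⟨R y, h⟩ = y

/-- The graph norm of `A` on its domain. -/
def graphNorm (A : H →ₗ.[ℂ] H) (x : A.domain) : ℝ :=
  √(‖(x : H)‖ ^ 2 + ‖A x‖ ^ 2)

/-- The filter `ε ↓ 0` on the positive reals. -/
def towardsZero : Filter (Set.Ioi (0 : ℝ)) :=
  comap Subtype.val (𝓝[>] (0 : ℝ))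

/-- `x ε = y + O(ε)` as `ε ↓ 0`, in the norm of `H`. -/
def EqAddBigO (x : Set.Ioi (0 : ℝ) → H) (y : H) : Prop :=
  (fun ε => x ε - y) =O[towardsZero] fun ε => (ε : ℝ)

/-- `x ε = y + O(ε)` as `ε ↓ 0`, in the graph norm of `A`;
all the vectors are required to lie in the domain of `A`. -/
def EqAddBigOGraph (A : H →ₗ.[ℂ] H) (x : Set.Ioi (0 : ℝ) → H) (y : H) : Prop :=
  ∃ (hx : ∀ ε, x ε ∈ A.domain) (hy : y ∈ A.domain),
    (fun ε => graphNorm A (⟨x ε, hx ε⟩ - ⟨y, hy⟩)) =O[towardsZero] fun ε => (ε : ℝ)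

/-- `T` is a self-adjoint operator acting in some closed subspace `K` of `N`
(dense domain in `K`, range in `K`, self-adjoint there), regarded as a partial operator of `H`. -/
def IsSelfAdjointInSubspace (N : Submodule ℂ H) (T : H →ₗ.[ℂ] H) : Prop :=
  ∃ (K : Submodule ℂ H) (_ : CompleteSpace K) (A : K →ₗ.[ℂ] K),
    K ≤ N ∧ IsSelfAdjoint A ∧ T.graph = A.graph.map (K.subtype.prodMap K.subtype)

variable [CompleteSpace H]

/-- The space `ker (S* - z)`: all `x` in the domain of `S*` with `S* x = z x`. -/
def deficiencySpace (S : H →ₗ.[ℂ] H) (z : ℂ) : Submodule ℂ H :=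
  S†.graph.comap (LinearMap.id.prod (z • LinearMap.id))

theorem mem_deficiencySpace_iff (S : H →ₗ.[ℂ] H) (z : ℂ) (x : H) :
    x ∈ deficiencySpace S z ↔ ∃ h : x ∈ S†.domain, S† ⟨x, h⟩ = z • x := by
  simp [deficiencySpace, LinearPMap.mem_graph_iff]

theorem deficiencySpace_le_domain (S : H →ₗ.[ℂ] H) (z : ℂ) :
    deficiencySpace S z ≤ S†.domain := fun x hx =>
  ((mem_deficiencySpace_iff S z x).1 hx).1

theorem isClosed_deficiencySpace {S : H →ₗ.[ℂ] H} (hS : Dense (S.domain : Set H)) (z : ℂ) :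
    IsClosed (deficiencySpace S z : Set H) := by
  have h : IsClosed (S†.graph : Set (H × H)) := LinearPMap.adjoint_isClosed hS
  have hc : Continuous fun x : H => (x, z • x) := by fun_prop
  exact h.preimage hc

/-- The orthogonal projection of `H` onto `ker (S* - z)`. -/
def deficiencyProj {S : H →ₗ.[ℂ] H} (hS : Dense (S.domain : Set H)) (z : ℂ) : H →L[ℂ] H :=
  haveI : CompleteSpace (deficiencySpace S z) := (isClosed_deficiencySpace hS z).completeSpace_coe
  (deficiencySpace S z).starProjection

/-- The inclusion of `ker (S* - z)` in the domain of `S*`. -/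
def toAdjointDomain (S : H →ₗ.[ℂ] H) (z : ℂ) : deficiencySpace S z →ₗ[ℂ] S†.domain :=
  Submodule.inclusion (deficiencySpace_le_domain S z)

/-- The graph of the von Neumann extension `S_U` at the spectral point `iε`,
`S_U (f + u - U u) = S̄ f + iε u + iε U u`. -/
def vonNeumannGraph (S : H →ₗ.[ℂ] H) (ε : ℝ)
    (U : deficiencySpace S (Complex.I * ε) ≃ₗᵢ[ℂ] deficiencySpace S (-(Complex.I * ε))) :
    Set (H × H) :=
  {p | ∃ (f : S.closure.domain) (u : deficiencySpace S (Complex.I * ε)),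
    p.1 = f + u - U u ∧
    p.2 = S.closure f + (Complex.I * ε) • (u : H) + (Complex.I * ε) • (U u : H)}

/-- `U` is the von Neumann parameter of the extension `A` of `S` at `iε`, i.e. `A = S_U`. -/
def IsVonNeumannParameter (S A : H →ₗ.[ℂ] H) (ε : ℝ)
    (U : deficiencySpace S (Complex.I * ε) ≃ₗᵢ[ℂ] deficiencySpace S (-(Complex.I * ε))) : Prop :=
  (A.graph : Set (H × H)) = vonNeumannGraph S ε U

/-- The space `ker S* ∩ D(T)ᗮ`. -/
def coDomainSpace (S T : H →ₗ.[ℂ] H) : Submodule ℂ H :=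
  deficiencySpace S 0 ⊓ T.domainᗮ

/-- The graph of the extension `S_T` of `S`, relative to the inverse `R` of the
distinguished extension, `S_T (f + R (T u + w) + u) = S̄ f + T u + w`. -/
def relativeGraph (S : H →ₗ.[ℂ] H) (R : H →L[ℂ] H) (T : H →ₗ.[ℂ] H) : Set (H × H) :=
  {p | ∃ (f : S.closure.domain) (u : T.domain) (w : coDomainSpace S T),
    p.1 = f + R (T u + w) + u ∧ p.2 = S.closure f + T u + w}

/-- `T` is the parameter of the extension `A` of `S` relative to the distinguished extension with
inverse `R`: a self-adjoint operator in a closed subspace of `ker S*` with `A = S_T`. -/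
def IsRelativeParameter (S A : H →ₗ.[ℂ] H) (R : H →L[ℂ] H) (T : H →ₗ.[ℂ] H) : Prop :=
  IsSelfAdjointInSubspace (deficiencySpace S 0) T ∧
    (A.graph : Set (H × H)) = relativeGraph S R T

end ExtensionTheory

end

/-!
For `ε > 0` the Cayley transform `(A - iε) (A + iε)⁻¹` is a unitary operator of `H` which maps the
range of `S̄ + iε` onto that of `S̄ - iε`, hence the orthogonal complement `ker (S* - iε)` of the
former onto the orthogonal complement `ker (S* + iε)` of the latter. The von Neumann parameter of
`A` is the restriction to these spaces.

Let `R` be the inverse of the distinguished extension. Modulo the graph of `S̄`, every element of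
the graph of `S*` is uniquely of the form `(R n + v, n)` with `v`, `n` in `ker S*`. By the modular
law, the subspaces between the graphs of `S̄` and `S*` thus correspond bijectively to the linear
relations in `ker S*`, and this correspondence respects adjoints because `R` is symmetric. A
self-adjoint relation is the sum of the graph of a self-adjoint operator `T` and of the purely
multivalued relation `{0} × (ker S* ∩ D(T)ᗮ)`.

For the limits, `h = f_ε - f` solves `S* S̄ h + ε² h = ε² (g - f)`. Pairing with `h` gives
`‖S̄ h‖² ≤ ε² ‖h‖ ‖g - f‖`, and `h = R S̄ h` then yields `‖S̄ f_ε - S̄ f‖ ≤ ε² ‖R‖ ‖g - f‖`. All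
other limits are deduced from this one, because `u_ε - U_ε u_ε = g - f_ε` and
`iε u_ε + iε U_ε u_ε = A g - S̄ f_ε`.
-/

namespace ExtensionTheory

section PartialOperators

variable {H : Type*} [NormedAddCommGroup H] [InnerProductSpace ℂ H] {S A B : H →ₗ.[ℂ] H}

theorem mem_graph_of_le (h : B ≤ A) (x : B.domain) : ((x : H), B x) ∈ A.graph :=
  LinearPMap.le_graph_of_le h (B.mem_graph x)

theorem apply_eq_of_mem_graph {x y : H} (h : (x, y) ∈ A.graph) (hx : x ∈ A.domain) :
    A ⟨x, hx⟩ = y :=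
  A.mem_graph_snd_inj (A.mem_graph ⟨x, hx⟩) h rfl

theorem isFormalAdjoint_of_le (hA : A.IsFormalAdjoint A) (h : B ≤ A) : B.IsFormalAdjoint B := by
  intro x y
  rw [h.2 (y := ⟨x, h.1 x.2⟩) rfl, h.2 (y := ⟨y, h.1 y.2⟩) rfl]
  exact hA ⟨x, h.1 x.2⟩ ⟨y, h.1 y.2⟩

theorem dense_domain_closure (hS : Dense (S.domain : Set H)) :
    Dense (S.closure.domain : Set H) :=
  hS.mono S.le_closure.1

theorem closure_le_of_isClosed (hA : A.IsClosed) (h : S ≤ A) : S.closure ≤ A := by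
  refine LinearPMap.le_of_le_graph ?_
  rw [← (hA.isClosable.leIsClosable h).graph_closure_eq_closure_graph]
  exact Submodule.topologicalClosure_minimal _ (LinearPMap.le_graph_of_le h) hA

theorem IsRegularTypePoint.eq_zero {z : ℂ} (hz : IsRegularTypePoint B z) {x : H}
    (hx : (x, z • x) ∈ B.graph) : x = 0 := by
  obtain ⟨c, hc, hbound⟩ := hz
  obtain ⟨y, rfl, hy⟩ := B.mem_graph_iff.1 hx
  have h : c * ‖(y : H)‖ ≤ 0 := by simpa [hy] using hbound y
  exact norm_le_zero_iff.1 (nonpos_of_mul_nonpos_right h hc)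

/-- The range of the operator `B - z`; for `B = S.closure` it is the orthogonal companion of the
deficiency space at the conjugate of `z`. -/
def shiftedRange (B : H →ₗ.[ℂ] H) (z : ℂ) : Submodule ℂ H :=
  LinearMap.range (B.toFun - z • B.domain.subtype)

theorem mem_shiftedRange {z : ℂ} {y : H} :
    y ∈ shiftedRange B z ↔ ∃ x : B.domain, B x - z • (x : H) = y :=
  Iff.rfl

theorem norm_prodMk_le_of_mul_norm_le {x y : H} {z : ℂ} {c : ℝ} (hc : 0 < c)
    (h : c * ‖x‖ ≤ ‖y - z • x‖) : ‖(x, y)‖ ≤ (1 + (1 + ‖z‖) / c) * ‖y - z • x‖ := by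
  set r := ‖y - z • x‖
  have hx : ‖x‖ ≤ r / c := by rwa [le_div_iff₀' hc]
  have hy : ‖y‖ ≤ r + ‖z‖ * (r / c) := calc
    ‖y‖ = ‖(y - z • x) + z • x‖ := by rw [sub_add_cancel]
    _ ≤ r + ‖z‖ * ‖x‖ := norm_add_le_of_le le_rfl (norm_smul _ _).le
    _ ≤ r + ‖z‖ * (r / c) := by gcongr
  have hr : 0 ≤ r := norm_nonneg _
  have hrc : 0 ≤ r / c := by positivity
  have hzrc : 0 ≤ ‖z‖ * (r / c) := by positivity
  calc ‖(x, y)‖ ≤ r + r / c + ‖z‖ * (r / c) := max_le (by linarith) (by linarith)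
    _ = (1 + (1 + ‖z‖) / c) * r := by ring

theorem isClosed_shiftedRange [CompleteSpace H] (hB : B.IsClosed) {z : ℂ}
    (hz : IsRegularTypePoint B z) : IsClosed (shiftedRange B z : Set H) := by
  obtain ⟨c, hc, hbound⟩ := hz
  have : CompleteSpace B.graph := IsClosed.completeSpace_coe (hs := hB)
  let φ : B.graph →L[ℂ] H :=
    (ContinuousLinearMap.snd ℂ H H - z • ContinuousLinearMap.fst ℂ H H).comp B.graph.subtypeL
  have hrange : (shiftedRange B z : Set H) = Set.range φ := by
    ext y
    constructor
    · rintro ⟨x, rfl⟩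
      exact ⟨⟨(x, B x), B.mem_graph x⟩, rfl⟩
    · rintro ⟨⟨⟨a, b⟩, hp⟩, rfl⟩
      obtain ⟨x, rfl, rfl⟩ := B.mem_graph_iff.1 hp
      exact ⟨x, rfl⟩
  have hbelow (p : B.graph) : ‖p‖ ≤ (1 + (1 + ‖z‖) / c) * ‖φ p‖ := by
    obtain ⟨⟨a, b⟩, hp⟩ := p
    obtain ⟨x, rfl, rfl⟩ := B.mem_graph_iff.1 hp
    exact norm_prodMk_le_of_mul_norm_le hc (hbound x)
  have hanti : AntilipschitzWith (Real.toNNReal (1 + (1 + ‖z‖) / c)) φ :=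
    AddMonoidHomClass.antilipschitz_of_bound φ fun p => by
      rw [Real.coe_toNNReal _ (by positivity)]
      exact hbelow p
  rw [hrange]
  exact hanti.isClosed_range φ.uniformContinuous

theorem norm_sub_I_mul_smul_sq (hB : B.IsFormalAdjoint B) (t : ℝ) (x : B.domain) :
    ‖B x - (Complex.I * t) • (x : H)‖ ^ 2 = ‖B x‖ ^ 2 + t ^ 2 * ‖(x : H)‖ ^ 2 := by
  have him : (inner ℂ (B x) (x : H)).im = 0 := by
    have h := inner_conj_symm (𝕜 := ℂ) (B x) (x : H)
    rw [← hB x x] at h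
    exact Complex.conj_eq_iff_im.1 h
  rw [@norm_sub_sq ℂ, inner_smul_right, norm_smul]
  simp [him, mul_pow]

theorem isRegularTypePoint_I_mul (hB : B.IsFormalAdjoint B) {t : ℝ} (ht : t ≠ 0) :
    IsRegularTypePoint B (Complex.I * t) := by
  refine ⟨|t|, abs_pos.2 ht, fun x => le_of_sq_le_sq ?_ (norm_nonneg _)⟩
  rw [norm_sub_I_mul_smul_sq hB, mul_pow, sq_abs]
  exact le_add_of_nonneg_left (sq_nonneg _)

theorem isRegularTypePoint_neg_I_mul (hB : B.IsFormalAdjoint B) {t : ℝ} (ht : t ≠ 0) :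
    IsRegularTypePoint B (-(Complex.I * t)) := by
  simpa using isRegularTypePoint_I_mul hB (neg_ne_zero.2 ht)

theorem eq_and_eq_of_add_smul_eq_of_sub_smul_eq {z : ℂ} (hz : z ≠ 0) {x x' y y' : H}
    (hadd : y + z • x = y' + z • x') (hsub : y - z • x = y' - z • x') : x = x' ∧ y = y' := by
  constructor
  · apply smul_right_injective H (mul_ne_zero two_ne_zero hz)
    linear_combination (norm := module) hadd - hsub
  · apply smul_right_injective H (two_ne_zero (α := ℂ))
    linear_combination (norm := module) hadd + hsub

end PartialOperators

section Adjoint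

variable {H : Type*} [NormedAddCommGroup H] [InnerProductSpace ℂ H] [CompleteSpace H]
  {S A : H →ₗ.[ℂ] H}

theorem mem_adjoint_graph_iff (hS : Dense (S.domain : Set H)) {x y : H} :
    (x, y) ∈ S†.graph ↔ ∀ f : S.domain, inner ℂ (S f) x = inner ℂ (f : H) y := by
  simp [LinearPMap.adjoint_graph_eq_graph_adjoint hS, sub_eq_zero]

theorem isFormalAdjoint_self_of_isSelfAdjoint (hA : IsSelfAdjoint A) : A.IsFormalAdjoint A := by
  have h := LinearPMap.adjoint_isFormalAdjoint hA.dense_domain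
  rwa [LinearPMap.isSelfAdjoint_def.1 hA] at h

theorem adjoint_graph_of_isSelfAdjoint (hA : IsSelfAdjoint A) : A.graph.adjoint = A.graph := by
  rw [← LinearPMap.adjoint_graph_eq_graph_adjoint hA.dense_domain,
    LinearPMap.isSelfAdjoint_def.1 hA]

theorem le_adjoint_of_le_isSelfAdjoint (hS : Dense (S.domain : Set H)) (hA : IsSelfAdjoint A)
    (h : S ≤ A) : A ≤ S† := by
  refine LinearPMap.IsFormalAdjoint.le_adjoint hS fun x y => ?_
  rw [h.2 (y := ⟨x, h.1 x.2⟩) rfl]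
  exact isFormalAdjoint_self_of_isSelfAdjoint hA ⟨x, h.1 x.2⟩ y

theorem adjoint_closure (hS : Dense (S.domain : Set H)) (hcl : S.IsClosable) :
    S.closure† = S† := by
  refine LinearPMap.eq_of_eq_graph (le_antisymm ?_ ?_) <;> rintro ⟨x, y⟩ hxy
  · refine (mem_adjoint_graph_iff hS).2 fun f => ?_
    rw [S.le_closure.2 (y := ⟨f, S.le_closure.1 f.2⟩) rfl]
    exact (mem_adjoint_graph_iff (dense_domain_closure hS)).1 hxy _
  · refine (mem_adjoint_graph_iff (dense_domain_closure hS)).2 fun f => ?_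
    have hclosed : IsClosed {p : H × H | inner ℂ p.2 x = inner ℂ p.1 y} :=
      isClosed_eq (by fun_prop) (by fun_prop)
    have hgraph : (S.graph : Set (H × H)) ⊆ {p | inner ℂ p.2 x = inner ℂ p.1 y} := by
      rintro ⟨a, b⟩ hab
      obtain ⟨a, rfl, rfl⟩ := S.mem_graph_iff.1 hab
      exact (mem_adjoint_graph_iff hS).1 hxy a
    have hf : ((f : H), S.closure f) ∈ S.graph.topologicalClosure := by
      rw [hcl.graph_closure_eq_closure_graph]
      exact S.closure.mem_graph f
    exact closure_minimal hgraph hclosed hf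

theorem inner_closure_left (hS : Dense (S.domain : Set H)) (hcl : S.IsClosable) {x y : H}
    (hxy : (x, y) ∈ S†.graph) (f : S.closure.domain) :
    inner ℂ (S.closure f) x = inner ℂ (f : H) y := by
  rw [← adjoint_closure hS hcl] at hxy
  exact (mem_adjoint_graph_iff (dense_domain_closure hS)).1 hxy f

end Adjoint

section DeficiencySpaces

variable {H : Type*} [NormedAddCommGroup H] [InnerProductSpace ℂ H] [CompleteSpace H]
  {S : H →ₗ.[ℂ] H}

theorem mem_deficiencySpace {z : ℂ} {x : H} :
    x ∈ deficiencySpace S z ↔ (x, z • x) ∈ S†.graph :=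
  Iff.rfl

theorem mem_deficiencySpace_zero {x : H} : x ∈ deficiencySpace S 0 ↔ (x, 0) ∈ S†.graph := by
  rw [mem_deficiencySpace, zero_smul]

theorem adjoint_toAdjointDomain (z : ℂ) (u : deficiencySpace S z) :
    S† (toAdjointDomain S z u) = z • (u : H) :=
  apply_eq_of_mem_graph (mem_deficiencySpace.1 u.2) (deficiencySpace_le_domain S z u.2)

theorem shiftedRange_orthogonal (hS : Dense (S.domain : Set H)) (z : ℂ) :
    (shiftedRange S z)ᗮ = deficiencySpace S (starRingEnd ℂ z) := by
  ext y
  rw [mem_deficiencySpace, mem_adjoint_graph_iff hS, Submodule.mem_orthogonal]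
  simp only [mem_shiftedRange, forall_exists_index, forall_apply_eq_imp_iff, inner_sub_left,
    inner_smul_left, inner_smul_right, sub_eq_zero]

theorem shiftedRange_closure_orthogonal (hS : Dense (S.domain : Set H)) (hcl : S.IsClosable)
    (z : ℂ) : (shiftedRange S.closure z)ᗮ = deficiencySpace S (starRingEnd ℂ z) := by
  rw [shiftedRange_orthogonal (dense_domain_closure hS), deficiencySpace, adjoint_closure hS hcl,
    deficiencySpace]

theorem deficiencySpace_orthogonal (hS : Dense (S.domain : Set H)) (hcl : S.IsClosable) {z : ℂ}
    (hz : IsRegularTypePoint S.closure (starRingEnd ℂ z)) :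
    (deficiencySpace S z)ᗮ = shiftedRange S.closure (starRingEnd ℂ z) := by
  have : CompleteSpace (shiftedRange S.closure (starRingEnd ℂ z)) :=
    (isClosed_shiftedRange hcl.closure_isClosed hz).completeSpace_coe
  have h := shiftedRange_closure_orthogonal hS hcl (starRingEnd ℂ z)
  rw [Complex.conj_conj] at h
  rw [← h, Submodule.orthogonal_orthogonal]

theorem closure_sub_smul_mem_orthogonal (hS : Dense (S.domain : Set H)) (hcl : S.IsClosable)
    (z : ℂ) (f : S.closure.domain) :
    S.closure f - (starRingEnd ℂ z) • (f : H) ∈ (deficiencySpace S z)ᗮ := by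
  have h := shiftedRange_closure_orthogonal hS hcl (starRingEnd ℂ z)
  rw [Complex.conj_conj] at h
  rw [← h]
  exact Submodule.le_orthogonal_orthogonal _ ⟨f, rfl⟩

theorem closure_apply_mem_orthogonal (hS : Dense (S.domain : Set H)) (hcl : S.IsClosable)
    (f : S.closure.domain) : S.closure f ∈ (deficiencySpace S 0)ᗮ := by
  simpa using closure_sub_smul_mem_orthogonal hS hcl 0 f

theorem exists_closure_sub_smul_add (hS : Dense (S.domain : Set H)) (hcl : S.IsClosable) {z : ℂ}
    (hz : IsRegularTypePoint S.closure (starRingEnd ℂ z)) (y : H) :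
    ∃ (f : S.closure.domain) (n : deficiencySpace S z),
      y = S.closure f - (starRingEnd ℂ z) • (f : H) + n := by
  have : CompleteSpace (deficiencySpace S z) := (isClosed_deficiencySpace hS z).completeSpace_coe
  obtain ⟨n, hn, q, hq, rfl⟩ :=
    Submodule.exists_add_mem_mem_orthogonal (K := deficiencySpace S z) y
  rw [deficiencySpace_orthogonal hS hcl hz] at hq
  obtain ⟨f, rfl⟩ := mem_shiftedRange.1 hq
  exact ⟨f, ⟨n, hn⟩, add_comm _ _⟩

theorem deficiencyProj_closure_sub_smul_add (hS : Dense (S.domain : Set H)) (hcl : S.IsClosable)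
    (z : ℂ) (f : S.closure.domain) {n : H} (hn : n ∈ deficiencySpace S z) :
    deficiencyProj hS z (S.closure f - (starRingEnd ℂ z) • (f : H) + n) = n :=
  have : CompleteSpace (deficiencySpace S z) := (isClosed_deficiencySpace hS z).completeSpace_coe
  Submodule.eq_starProjection_of_mem_orthogonal' hn (closure_sub_smul_mem_orthogonal hS hcl z f)
    (add_comm _ _)

end DeficiencySpaces

section Cayley

variable {H : Type*} [NormedAddCommGroup H] [InnerProductSpace ℂ H] [CompleteSpace H]
  {S A : H →ₗ.[ℂ] H}

theorem shiftedRange_I_mul_eq_top (hA : IsSelfAdjoint A) {t : ℝ} (ht : t ≠ 0) :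
    shiftedRange A (Complex.I * t) = ⊤ := by
  have hsymm := isFormalAdjoint_self_of_isSelfAdjoint hA
  have : CompleteSpace (shiftedRange A (Complex.I * t)) :=
    (isClosed_shiftedRange hA.isClosed (isRegularTypePoint_I_mul hsymm ht)).completeSpace_coe
  rw [← Submodule.orthogonal_eq_bot_iff, shiftedRange_orthogonal hA.dense_domain, eq_bot_iff]
  intro x hx
  rw [mem_deficiencySpace, LinearPMap.isSelfAdjoint_def.1 hA] at hx
  exact (isRegularTypePoint_neg_I_mul hsymm ht).eq_zero (by simpa using hx)

/-- The bijection `A - it` of the domain of a self-adjoint operator `A` onto the whole space. -/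
noncomputable def shiftEquiv (hA : IsSelfAdjoint A) {t : ℝ} (ht : t ≠ 0) : A.domain ≃ₗ[ℂ] H :=
  LinearEquiv.ofBijective (A.toFun - (Complex.I * t : ℂ) • A.domain.subtype) <| by
    refine ⟨(injective_iff_map_eq_zero _).2 fun x hx => Subtype.ext ?_,
      LinearMap.range_eq_top.1 (shiftedRange_I_mul_eq_top hA ht)⟩
    have hx' : A x = (Complex.I * t) • (x : H) := sub_eq_zero.1 hx
    exact (isRegularTypePoint_I_mul (isFormalAdjoint_self_of_isSelfAdjoint hA) ht).eq_zero
      (hx' ▸ A.mem_graph x)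

theorem shiftEquiv_apply (hA : IsSelfAdjoint A) {t : ℝ} (ht : t ≠ 0) (x : A.domain) :
    shiftEquiv hA ht x = A x - (Complex.I * t) • (x : H) :=
  rfl

theorem shiftEquiv_neg_apply (hA : IsSelfAdjoint A) {t : ℝ} (ht : -t ≠ 0) (x : A.domain) :
    shiftEquiv hA ht x = A x + (Complex.I * t) • (x : H) := by
  rw [shiftEquiv_apply]
  push_cast
  module

/-- The Cayley transform `(A - it) (A + it)⁻¹` of a self-adjoint operator `A`. -/
noncomputable def cayley (hA : IsSelfAdjoint A) {t : ℝ} (ht : t ≠ 0) : H ≃ₗᵢ[ℂ] H where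
  toLinearEquiv := (shiftEquiv hA (neg_ne_zero.2 ht)).symm.trans (shiftEquiv hA ht)
  norm_map' y := by
    have hsymm := isFormalAdjoint_self_of_isSelfAdjoint hA
    obtain ⟨x, rfl⟩ := (shiftEquiv hA (neg_ne_zero.2 ht)).surjective y
    rw [LinearEquiv.trans_apply, LinearEquiv.symm_apply_apply, shiftEquiv_apply, shiftEquiv_apply,
      ← sq_eq_sq₀ (norm_nonneg _) (norm_nonneg _), norm_sub_I_mul_smul_sq hsymm,
      norm_sub_I_mul_smul_sq hsymm, neg_sq]

theorem cayley_apply (hA : IsSelfAdjoint A) {t : ℝ} (ht : t ≠ 0) (x : A.domain) :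
    cayley hA ht (A x + (Complex.I * t) • (x : H)) = A x - (Complex.I * t) • (x : H) := by
  rw [← shiftEquiv_neg_apply hA (neg_ne_zero.2 ht), ← shiftEquiv_apply hA ht]
  exact congrArg (shiftEquiv hA ht) (LinearEquiv.symm_apply_apply _ _)

theorem I_mul_ne_zero {t : ℝ} (ht : t ≠ 0) : Complex.I * (t : ℂ) ≠ 0 := by
  simp [ht]

theorem mem_graph_iff_cayley (hA : IsSelfAdjoint A) {t : ℝ} (ht : t ≠ 0) {x y : H} :
    (x, y) ∈ A.graph ↔
      cayley hA ht (y + (Complex.I * t) • x) = y - (Complex.I * t) • x := by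
  constructor
  · intro h
    obtain ⟨a, rfl, rfl⟩ := A.mem_graph_iff.1 h
    exact cayley_apply hA ht a
  · intro h
    obtain ⟨a, ha⟩ := (shiftEquiv hA (neg_ne_zero.2 ht)).surjective (y + (Complex.I * t) • x)
    rw [shiftEquiv_neg_apply] at ha
    rw [← ha, cayley_apply] at h
    obtain ⟨rfl, rfl⟩ := eq_and_eq_of_add_smul_eq_of_sub_smul_eq (I_mul_ne_zero ht) ha h
    exact A.mem_graph a

theorem conj_I_mul (t : ℝ) : starRingEnd ℂ (Complex.I * t) = -(Complex.I * t) := by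
  simp

theorem cayley_closure_apply (hA : IsSelfAdjoint A) (hSA : S ≤ A) {t : ℝ} (ht : t ≠ 0)
    (f : S.closure.domain) :
    cayley hA ht (S.closure f + (Complex.I * t) • (f : H)) =
      S.closure f - (Complex.I * t) • (f : H) :=
  (mem_graph_iff_cayley hA ht).1 (mem_graph_of_le (closure_le_of_isClosed hA.isClosed hSA) f)

theorem map_cayley_deficiencySpace (hS : Dense (S.domain : Set H)) (hA : IsSelfAdjoint A)
    (hSA : S ≤ A) {t : ℝ} (ht : t ≠ 0) :
    (deficiencySpace S (Complex.I * t)).map ((cayley hA ht).toLinearEquiv : H →ₗ[ℂ] H) =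
      deficiencySpace S (-(Complex.I * t)) := by
  have hcl : S.IsClosable := hA.isClosed.isClosable.leIsClosable hSA
  have hadd := shiftedRange_closure_orthogonal hS hcl (-(Complex.I * t))
  have hsub := shiftedRange_closure_orthogonal hS hcl (Complex.I * t)
  rw [map_neg, conj_I_mul, neg_neg] at hadd
  rw [conj_I_mul] at hsub
  rw [← hadd, ← hsub, Submodule.map_orthogonal_equiv]
  congr 1
  have hcayley (f : S.closure.domain) :
      cayley hA ht (S.closure f - (-(Complex.I * t)) • (f : H)) =
        S.closure f - (Complex.I * t) • (f : H) := by
    rw [neg_smul, sub_neg_eq_add, cayley_closure_apply hA hSA ht f]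
  ext y
  constructor
  · rintro ⟨_, ⟨f, rfl⟩, rfl⟩
    exact ⟨f, (hcayley f).symm⟩
  · rintro ⟨f, rfl⟩
    exact ⟨_, ⟨f, rfl⟩, hcayley f⟩

end Cayley

section VonNeumann

variable {H : Type*} [NormedAddCommGroup H] [InnerProductSpace ℂ H] [CompleteSpace H]
  {S A : H →ₗ.[ℂ] H} {ε : ℝ}
  {U : deficiencySpace S (Complex.I * ε) ≃ₗᵢ[ℂ] deficiencySpace S (-(Complex.I * ε))}

theorem mem_vonNeumannGraph_iff (hε : ε ≠ 0) {x y : H} :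
    (x, y) ∈ vonNeumannGraph S ε U ↔
      ∃ (f : S.closure.domain) (u : deficiencySpace S (Complex.I * ε)),
        y + (Complex.I * ε) • x =
          S.closure f + (Complex.I * ε) • (f : H) + (2 * Complex.I * ε) • (u : H) ∧
        y - (Complex.I * ε) • x =
          S.closure f - (Complex.I * ε) • (f : H) + (2 * Complex.I * ε) • (U u : H) := by
  refine exists_congr fun f => exists_congr fun u => ⟨?_, ?_⟩
  · rintro ⟨hx, hy⟩
    simp only at hx hy
    rw [hx, hy]
    constructor <;> module
  · rintro ⟨hadd, hsub⟩
    refine eq_and_eq_of_add_smul_eq_of_sub_smul_eq (I_mul_ne_zero hε) ?_ ?_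
    · linear_combination (norm := module) hadd
    · linear_combination (norm := module) hsub

theorem two_mul_I_mul_ne_zero (hε : ε ≠ 0) : 2 * Complex.I * (ε : ℂ) ≠ 0 := by
  simp [hε]

theorem exists_closure_add_smul_add (hS : Dense (S.domain : Set H)) (hA : IsSelfAdjoint A)
    (hSA : S ≤ A) (hε : ε ≠ 0) (y : H) :
    ∃ (f : S.closure.domain) (u : deficiencySpace S (Complex.I * ε)),
      y = S.closure f + (Complex.I * ε) • (f : H) + (2 * Complex.I * ε) • (u : H) := by
  have hsymm : S.closure.IsFormalAdjoint S.closure :=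
    isFormalAdjoint_of_le (isFormalAdjoint_self_of_isSelfAdjoint hA)
      (closure_le_of_isClosed hA.isClosed hSA)
  obtain ⟨f, n, rfl⟩ := exists_closure_sub_smul_add (z := Complex.I * ε) hS
    (hA.isClosed.isClosable.leIsClosable hSA)
    (by simpa only [conj_I_mul] using isRegularTypePoint_neg_I_mul hsymm hε) y
  refine ⟨f, (2 * Complex.I * ε)⁻¹ • n, ?_⟩
  rw [Submodule.coe_smul, smul_inv_smul₀ (two_mul_I_mul_ne_zero hε), conj_I_mul, neg_smul,
    sub_neg_eq_add]

theorem IsVonNeumannParameter.mk_mem_graph (hU : IsVonNeumannParameter S A ε U)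
    (u : deficiencySpace S (Complex.I * ε)) :
    ((u : H) - U u, (Complex.I * ε) • (u : H) + (Complex.I * ε) • (U u : H)) ∈ A.graph := by
  rw [← SetLike.mem_coe, hU]
  exact ⟨0, u, by simp, by simp [LinearPMap.map_zero]⟩

theorem isVonNeumannParameter_iff_eq_cayley (hS : Dense (S.domain : Set H))
    (hA : IsSelfAdjoint A) (hSA : S ≤ A) (hε : ε ≠ 0) :
    IsVonNeumannParameter S A ε U ↔ ∀ u, (U u : H) = cayley hA hε u := by
  constructor
  · intro hU u
    have hcayley := (mem_graph_iff_cayley hA hε).1 (hU.mk_mem_graph u)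
    apply smul_right_injective H (two_mul_I_mul_ne_zero hε)
    dsimp only
    rw [← map_smul]
    convert hcayley.symm using 2 <;> module
  · intro hU
    ext ⟨x, y⟩
    rw [SetLike.mem_coe, mem_graph_iff_cayley hA hε, mem_vonNeumannGraph_iff hε]
    constructor
    · intro h
      obtain ⟨f, u, hfu⟩ :=
        exists_closure_add_smul_add hS hA hSA hε (y + (Complex.I * ε) • x)
      refine ⟨f, u, hfu, ?_⟩
      rw [← h, hfu, map_add, cayley_closure_apply hA hSA, map_smul, hU]
    · rintro ⟨f, u, hadd, hsub⟩
      rw [hadd, hsub, map_add, cayley_closure_apply hA hSA, map_smul, hU]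

theorem existsUnique_isVonNeumannParameter (hS : Dense (S.domain : Set H))
    (hA : IsSelfAdjoint A) (hSA : S ≤ A) (hε : ε ≠ 0) :
    ∃! U, IsVonNeumannParameter S A ε U := by
  simp only [isVonNeumannParameter_iff_eq_cayley hS hA hSA hε]
  refine ⟨((cayley hA hε).submoduleMap _).trans
    (.ofEq _ _ (map_cayley_deficiencySpace hS hA hSA hε)), fun u => rfl, fun U' hU' => ?_⟩
  ext u
  exact hU' u

variable {g : A.domain} {f : S.closure.domain} {u : deficiencySpace S (Complex.I * ε)}

theorem IsVonNeumannParameter.apply_eq (hU : IsVonNeumannParameter S A ε U)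
    (hg : (g : H) = f + u - U u) :
    A g = S.closure f + (Complex.I * ε) • (u : H) + (Complex.I * ε) • (U u : H) := by
  have hmem : ((g : H), S.closure f + (Complex.I * ε) • (u : H) + (Complex.I * ε) • (U u : H)) ∈
      (A.graph : Set (H × H)) := by
    rw [hU]
    exact ⟨f, u, hg, rfl⟩
  exact apply_eq_of_mem_graph hmem g.2

theorem IsVonNeumannParameter.coe_eq_smul_deficiencyProj (hU : IsVonNeumannParameter S A ε U)
    (hS : Dense (S.domain : Set H)) (hcl : S.IsClosable) (hε : ε ≠ 0)
    (hg : (g : H) = f + u - U u) :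
    (u : H) = (2 * Complex.I * ε)⁻¹ •
      deficiencyProj hS (Complex.I * ε) (A g + (Complex.I * ε) • (g : H)) := by
  have hsum : A g + (Complex.I * ε) • (g : H) =
      S.closure f - (starRingEnd ℂ (Complex.I * ε)) • (f : H) +
        (2 * Complex.I * ε) • (u : H) := by
    rw [conj_I_mul, hU.apply_eq hg, hg]
    module
  rw [hsum, deficiencyProj_closure_sub_smul_add hS hcl _ _ (Submodule.smul_mem _ _ u.2),
    inv_smul_smul₀ (two_mul_I_mul_ne_zero hε)]

theorem IsVonNeumannParameter.coe_apply_eq_smul_deficiencyProj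
    (hU : IsVonNeumannParameter S A ε U) (hS : Dense (S.domain : Set H)) (hcl : S.IsClosable)
    (hε : ε ≠ 0) (hg : (g : H) = f + u - U u) :
    (U u : H) = (2 * Complex.I * ε)⁻¹ •
      deficiencyProj hS (-(Complex.I * ε)) (A g - (Complex.I * ε) • (g : H)) := by
  have hdiff : A g - (Complex.I * ε) • (g : H) =
      S.closure f - (starRingEnd ℂ (-(Complex.I * ε))) • (f : H) +
        (2 * Complex.I * ε) • (U u : H) := by
    rw [map_neg, conj_I_mul, neg_neg, hU.apply_eq hg, hg]
    module
  rw [hdiff, deficiencyProj_closure_sub_smul_add hS hcl _ _ (Submodule.smul_mem _ _ (U u).2),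
    inv_smul_smul₀ (two_mul_I_mul_ne_zero hε)]

theorem IsVonNeumannParameter.existsUnique_components (hU : IsVonNeumannParameter S A ε U)
    (hS : Dense (S.domain : Set H)) (hcl : S.IsClosable) (hε : ε ≠ 0) (g : A.domain) :
    ∃! p : S.closure.domain × deficiencySpace S (Complex.I * ε),
      (g : H) = p.1 + p.2 - U p.2 := by
  have hmem : ((g : H), A g) ∈ vonNeumannGraph S ε U := hU ▸ A.mem_graph g
  obtain ⟨f, u, hg, -⟩ := hmem
  refine ⟨(f, u), hg, ?_⟩
  rintro ⟨f', u'⟩ hg'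
  obtain rfl : u' = u := Subtype.ext <|
    (hU.coe_eq_smul_deficiencyProj hS hcl hε hg').trans
      (hU.coe_eq_smul_deficiencyProj hS hcl hε hg).symm
  obtain rfl : f' = f := Subtype.ext (by simpa using hg'.symm.trans hg)
  rfl

end VonNeumann

section LinearRelations

variable {H : Type*} [NormedAddCommGroup H] [InnerProductSpace ℂ H] {N K : Submodule ℂ H}
  {T T' : H →ₗ.[ℂ] H} {L : Submodule ℂ (H × H)}

/-- The linear relation in `N` with operator part `T` and multivalued part `N ⊓ T.domainᗮ`. A linear
relation is encoded as a submodule of `H × H`. -/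
noncomputable def toRelation (N : Submodule ℂ H) (T : H →ₗ.[ℂ] H) : Submodule ℂ (H × H) :=
  T.graph ⊔ (⊥ : Submodule ℂ H).prod (N ⊓ T.domainᗮ)

theorem mem_toRelation {p : H × H} :
    p ∈ toRelation N T ↔ ∃ u : T.domain, ∃ w ∈ N ⊓ T.domainᗮ, ((u : H), T u + w) = p := by
  rw [toRelation, Submodule.mem_sup]
  constructor
  · rintro ⟨⟨x, y⟩, hxy, ⟨a, w⟩, ⟨ha, hw⟩, rfl⟩
    obtain ⟨u, rfl, rfl⟩ := T.mem_graph_iff.1 hxy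
    obtain rfl : a = 0 := ha
    exact ⟨u, w, hw, by simp⟩
  · rintro ⟨u, w, hw, rfl⟩
    exact ⟨_, T.mem_graph u, (0, w), ⟨Submodule.zero_mem _, hw⟩, by simp⟩

theorem map_fst_toRelation : (toRelation N T).map (LinearMap.fst ℂ H H) = T.domain := by
  rw [toRelation, Submodule.map_sup, LinearPMap.graph_map_fst_eq_domain, Submodule.prod_map_fst,
    sup_bot_eq]

theorem IsSelfAdjointInSubspace.graph_le (hT : IsSelfAdjointInSubspace N T) :
    T.graph ≤ N.prod (N ⊓ T.domain.topologicalClosure) := by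
  obtain ⟨K, hK, B, hKN, hB, hgraph⟩ := hT
  have hmaps : Set.MapsTo (Subtype.val : K → H) (B.domain : Set K) (T.domain : Set H) := by
    intro a ha
    refine LinearPMap.mem_domain_iff.2 ⟨B ⟨a, ha⟩, ?_⟩
    rw [hgraph]
    exact ⟨(a, B ⟨a, ha⟩), B.mem_graph ⟨a, ha⟩, rfl⟩
  rw [hgraph]
  rintro _ ⟨⟨x, y⟩, -, rfl⟩
  have hy : (y : H) ∈ T.domain.topologicalClosure :=
    map_mem_closure continuous_subtype_val (hB.dense_domain y) hmaps
  exact ⟨hKN x.2, hKN y.2, hy⟩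

theorem IsSelfAdjointInSubspace.toRelation_le (hT : IsSelfAdjointInSubspace N T) :
    toRelation N T ≤ N.prod N :=
  sup_le (hT.graph_le.trans (Submodule.prod_mono le_rfl inf_le_left))
    (Submodule.prod_mono bot_le inf_le_left)

theorem IsSelfAdjointInSubspace.graph_eq_toRelation_inf (hT : IsSelfAdjointInSubspace N T) :
    T.graph = toRelation N T ⊓ (⊤ : Submodule ℂ H).prod T.domain.topologicalClosure := by
  refine le_antisymm (le_inf le_sup_left
    (hT.graph_le.trans (Submodule.prod_mono le_top inf_le_right))) ?_
  rintro _ ⟨h, -, hclosure⟩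
  obtain ⟨u, w, hw, rfl⟩ := mem_toRelation.1 h
  have hw_closure : w ∈ T.domain.topologicalClosure :=
    (Submodule.add_mem_iff_right _ (hT.graph_le (T.mem_graph u)).2.2).1 hclosure
  have hw_orthogonal : w ∈ T.domain.topologicalClosureᗮ := by
    rw [Submodule.orthogonal_closure]
    exact hw.2
  have hw_zero : w = 0 := by
    rw [← Submodule.mem_bot (R := ℂ), ← T.domain.topologicalClosure.inf_orthogonal_eq_bot]
    exact ⟨hw_closure, hw_orthogonal⟩
  rw [hw_zero, add_zero]
  exact T.mem_graph u

theorem IsSelfAdjointInSubspace.eq_of_toRelation_eq (hT : IsSelfAdjointInSubspace N T)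
    (hT' : IsSelfAdjointInSubspace N T') (h : toRelation N T = toRelation N T') : T = T' := by
  apply LinearPMap.eq_of_eq_graph
  rw [hT.graph_eq_toRelation_inf, hT'.graph_eq_toRelation_inf, ← map_fst_toRelation (N := N),
    ← map_fst_toRelation (N := N) (T := T'), h]

/-- The closure of the domain of a linear relation, the space carrying its operator part. -/
def closureDomain (L : Submodule ℂ (H × H)) : Submodule ℂ H :=
  (L.map (LinearMap.fst ℂ H H)).topologicalClosure

theorem fst_mem_closureDomain {p : H × H} (hp : p ∈ L) : p.1 ∈ closureDomain L :=
  Submodule.le_topologicalClosure _ ⟨p, hp, rfl⟩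

theorem mem_closureDomain_orthogonal {y : H} :
    y ∈ (closureDomain L)ᗮ ↔ ∀ p ∈ L, inner ℂ p.1 y = 0 := by
  rw [closureDomain, Submodule.orthogonal_closure, Submodule.mem_orthogonal]
  simp only [Submodule.mem_map, forall_exists_index, and_imp, forall_apply_eq_imp_iff₂,
    LinearMap.fst_apply]

/-- The part of the linear relation `L` inside `closureDomain L`. It is an operator when `L` is
self-adjoint in a subspace. -/
noncomputable def operatorPart (L : Submodule ℂ (H × H)) :
    closureDomain L →ₗ.[ℂ] closureDomain L :=
  (L.comap ((closureDomain L).subtype.prodMap (closureDomain L).subtype)).toLinearPMap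

theorem exists_graph_eq_map_subtype (B : K →ₗ.[ℂ] K) :
    ∃ T : H →ₗ.[ℂ] H, T.graph = B.graph.map (K.subtype.prodMap K.subtype) := by
  refine ⟨_, Submodule.toLinearPMap_graph_eq _ ?_⟩
  rintro _ ⟨⟨x, y⟩, hxy, rfl⟩ hx
  obtain rfl : x = 0 := Subtype.ext hx
  exact congrArg Subtype.val (B.graph_fst_eq_zero_snd hxy rfl)

/-- The linear relation `L` is self-adjoint in the subspace `N`. -/
def IsSelfAdjointRelation (N : Submodule ℂ H) (L : Submodule ℂ (H × H)) : Prop :=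
  L.adjoint ⊓ N.prod N = L

theorem IsSelfAdjointRelation.mem_iff (hL : IsSelfAdjointRelation N L) {x y : H} :
    (x, y) ∈ L ↔ (∀ p ∈ L, inner ℂ p.2 x = inner ℂ p.1 y) ∧ x ∈ N ∧ y ∈ N := by
  conv_lhs => rw [← show L.adjoint ⊓ N.prod N = L from hL]
  simp [Submodule.mem_adjoint_iff, sub_eq_zero]

theorem IsSelfAdjointRelation.closureDomain_le (hL : IsSelfAdjointRelation N L)
    (hN : IsClosed (N : Set H)) : closureDomain L ≤ N := by
  refine Submodule.topologicalClosure_minimal _ ?_ hN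
  rintro _ ⟨⟨x, y⟩, hxy, rfl⟩
  exact ((hL.mem_iff).1 hxy).2.1

theorem IsSelfAdjointRelation.zero_mk_mem_iff (hL : IsSelfAdjointRelation N L) {w : H} :
    (0, w) ∈ L ↔ w ∈ N ⊓ (closureDomain L)ᗮ := by
  rw [hL.mem_iff, Submodule.mem_inf, mem_closureDomain_orthogonal]
  simp only [inner_zero_right, eq_comm (a := (0 : ℂ)), N.zero_mem, true_and]
  exact and_comm

theorem IsSelfAdjointRelation.graph_operatorPart (hL : IsSelfAdjointRelation N L) :
    (operatorPart L).graph =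
      L.comap ((closureDomain L).subtype.prodMap (closureDomain L).subtype) := by
  refine Submodule.toLinearPMap_graph_eq _ ?_
  rintro ⟨x, y⟩ hxy rfl
  have hy : (y : H) ∈ (closureDomain L)ᗮ :=
    ((hL.zero_mk_mem_iff).1 (by simpa using hxy)).2
  apply Subtype.ext
  rw [Submodule.coe_zero, ← Submodule.mem_bot (R := ℂ), ← (closureDomain L).inf_orthogonal_eq_bot]
  exact ⟨y.2, hy⟩

theorem IsSelfAdjointRelation.mk_mem_graph_operatorPart
    (hL : IsSelfAdjointRelation N L) {x y : closureDomain L} :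
    (x, y) ∈ (operatorPart L).graph ↔ ((x : H), (y : H)) ∈ L := by
  rw [hL.graph_operatorPart]
  rfl

variable [CompleteSpace H]

instance : CompleteSpace (closureDomain L) :=
  (Submodule.isClosed_topologicalClosure _).completeSpace_coe

theorem IsSelfAdjointRelation.exists_add_mem (hL : IsSelfAdjointRelation N L)
    (hN : IsClosed (N : Set H)) {x y : H} (hxy : (x, y) ∈ L) :
    ∃ m ∈ closureDomain L, ∃ w ∈ N ⊓ (closureDomain L)ᗮ, m + w = y ∧ (x, m) ∈ L := by
  obtain ⟨m, hm, w, hw, rfl⟩ :=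
    Submodule.exists_add_mem_mem_orthogonal (K := closureDomain L) y
  have hwN : w ∈ N := (Submodule.add_mem_iff_right _ (hL.closureDomain_le hN hm)).1
    ((hL.mem_iff).1 hxy).2.2
  refine ⟨m, hm, w, ⟨hwN, hw⟩, rfl, ?_⟩
  simpa using L.sub_mem hxy ((hL.zero_mk_mem_iff).2 ⟨hwN, hw⟩)

theorem IsSelfAdjointRelation.dense_domain_operatorPart (hL : IsSelfAdjointRelation N L)
    (hN : IsClosed (N : Set H)) :
    Dense ((operatorPart L).domain : Set (closureDomain L)) := by
  rw [Submodule.dense_iff_topologicalClosure_eq_top, Submodule.topologicalClosure_eq_top_iff,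
    eq_bot_iff]
  intro x hx
  have hxL : (x : H) ∈ (closureDomain L)ᗮ := by
    refine mem_closureDomain_orthogonal.2 fun ⟨a, b⟩ hab => ?_
    obtain ⟨m, hm, -, -, -, ham⟩ := hL.exists_add_mem hN hab
    exact (Submodule.mem_orthogonal _ _).1 hx ⟨a, fst_mem_closureDomain ham⟩
      (LinearPMap.mem_domain_iff.2 ⟨⟨m, hm⟩, (hL.mk_mem_graph_operatorPart).2 ham⟩)
  have hzero : (x : H) = 0 := (inner_self_eq_zero (𝕜 := ℂ)).1 (hxL x x.2)
  exact Subtype.ext hzero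

theorem IsSelfAdjointRelation.isSelfAdjoint_operatorPart (hL : IsSelfAdjointRelation N L)
    (hN : IsClosed (N : Set H)) : IsSelfAdjoint (operatorPart L) := by
  rw [LinearPMap.isSelfAdjoint_def]
  apply LinearPMap.eq_of_eq_graph
  rw [LinearPMap.adjoint_graph_eq_graph_adjoint (hL.dense_domain_operatorPart hN)]
  ext ⟨x, y⟩
  rw [Submodule.mem_adjoint_iff, hL.mk_mem_graph_operatorPart, hL.mem_iff]
  simp only [sub_eq_zero]
  constructor
  · refine fun h => ⟨fun ⟨a, b⟩ hab => ?_, hL.closureDomain_le hN x.2, hL.closureDomain_le hN y.2⟩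
    obtain ⟨m, hm, w, hw, rfl, ham⟩ := hL.exists_add_mem hN hab
    rw [inner_add_left, Submodule.inner_left_of_mem_orthogonal x.2 hw.2, add_zero]
    exact h ⟨a, fst_mem_closureDomain hab⟩ ⟨m, hm⟩ ((hL.mk_mem_graph_operatorPart).2 ham)
  · exact fun h a b hab => h.1 (a, b) ((hL.mk_mem_graph_operatorPart).1 hab)

theorem IsSelfAdjointRelation.inf_prod_sup_prod_eq (hL : IsSelfAdjointRelation N L)
    (hN : IsClosed (N : Set H)) :
    L ⊓ (closureDomain L).prod (closureDomain L) ⊔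
      (⊥ : Submodule ℂ H).prod (N ⊓ (closureDomain L)ᗮ) = L := by
  refine le_antisymm (sup_le inf_le_left ?_) ?_
  · rintro ⟨a, w⟩ ⟨ha, hw⟩
    obtain rfl : a = 0 := ha
    exact (hL.zero_mk_mem_iff).2 hw
  · rintro ⟨x, y⟩ hxy
    obtain ⟨m, hm, w, hw, rfl, hxm⟩ := hL.exists_add_mem hN hxy
    exact Submodule.mem_sup.2 ⟨(x, m), ⟨hxm, fst_mem_closureDomain hxm, hm⟩, (0, w),
      ⟨Submodule.zero_mem _, hw⟩, by simp⟩

theorem IsSelfAdjointRelation.exists_toRelation_eq (hL : IsSelfAdjointRelation N L)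
    (hN : IsClosed (N : Set H)) :
    ∃ T, IsSelfAdjointInSubspace N T ∧ toRelation N T = L := by
  obtain ⟨T, hT⟩ := exists_graph_eq_map_subtype (operatorPart L)
  have hgraph : T.graph = L ⊓ (closureDomain L).prod (closureDomain L) := by
    rw [hT, hL.graph_operatorPart, Submodule.map_comap_eq, LinearMap.range_prodMap,
      Submodule.range_subtype, inf_comm]
  have hsup := hL.inf_prod_sup_prod_eq hN
  rw [← hgraph] at hsup
  have hdomain : T.domain = L.map (LinearMap.fst ℂ H H) := by
    rw [← hsup, Submodule.map_sup, LinearPMap.graph_map_fst_eq_domain, Submodule.prod_map_fst,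
      sup_bot_eq]
  refine ⟨T, ⟨_, inferInstance, _, hL.closureDomain_le hN, hL.isSelfAdjoint_operatorPart hN, hT⟩,
    ?_⟩
  rwa [toRelation, hdomain, ← Submodule.orthogonal_closure]

end LinearRelations

section RelativeParameter

variable {H : Type*} [NormedAddCommGroup H] [InnerProductSpace ℂ H] {S : H →ₗ.[ℂ] H}
  {R : H →L[ℂ] H}

/-- The map `(v, n) ↦ (R n + v, n)`, which for a right inverse `R` of `S†` sends pairs of elements
of `ker S†` into the graph of `S†`. -/
noncomputable def boundaryLift (R : H →L[ℂ] H) : H × H →ₗ[ℂ] H × H :=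
  ((R : H →ₗ[ℂ] H).coprod LinearMap.id ∘ₗ LinearEquiv.prodComm ℂ H H).prod (LinearMap.snd ℂ H H)

theorem boundaryLift_apply (v n : H) : boundaryLift R (v, n) = (R n + v, n) :=
  rfl

theorem boundaryLift_injective : Function.Injective (boundaryLift R) := by
  rintro ⟨v, n⟩ ⟨v', n'⟩ h
  obtain ⟨hv, hn⟩ : R n + v = R n' + v' ∧ n = n' := Prod.mk.inj h
  subst hn
  rw [add_left_cancel hv]

/-- The extension of `S.closure` whose boundary values form the linear relation `L`. -/
noncomputable def extensionGraph (S : H →ₗ.[ℂ] H) (R : H →L[ℂ] H) (L : Submodule ℂ (H × H)) :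
    Submodule ℂ (H × H) :=
  S.closure.graph ⊔ L.map (boundaryLift R)

theorem mem_extensionGraph {L : Submodule ℂ (H × H)} {x y : H} :
    (x, y) ∈ extensionGraph S R L ↔ ∃ (f : S.closure.domain) (v n : H), (v, n) ∈ L ∧
      x = f + R n + v ∧ y = S.closure f + n := by
  rw [extensionGraph, Submodule.mem_sup]
  constructor
  · rintro ⟨⟨a, b⟩, hab, _, ⟨⟨v, n⟩, hvn, rfl⟩, hsum⟩
    obtain ⟨f, rfl, rfl⟩ := S.closure.mem_graph_iff.1 hab
    obtain ⟨rfl, rfl⟩ := Prod.mk.inj hsum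
    exact ⟨f, v, n, hvn, (add_assoc _ _ _).symm, rfl⟩
  · rintro ⟨f, v, n, hvn, rfl, rfl⟩
    refine ⟨_, S.closure.mem_graph f, _, ⟨(v, n), hvn, rfl⟩, ?_⟩
    rw [boundaryLift_apply, Prod.mk_add_mk, add_assoc]

variable [CompleteSpace H] {SD A T : H →ₗ.[ℂ] H}

/-- `R` is symmetric and a right inverse of `S†`. The inverse of a self-adjoint extension of `S` has
these properties, and they are all that is needed of it. -/
structure IsSymmetricRightInverse (S : H →ₗ.[ℂ] H) (R : H →L[ℂ] H) : Prop where
  inner_apply_left : ∀ x y, inner ℂ (R x) y = inner ℂ x (R y)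
  mem_adjoint_graph : ∀ y, (R y, y) ∈ S†.graph

theorem IsBoundedInverse.isSymmetricRightInverse (hR : IsBoundedInverse SD R)
    (hS : Dense (S.domain : Set H)) (hSD : IsSelfAdjoint SD) (hSSD : S ≤ SD) :
    IsSymmetricRightInverse S R where
  inner_apply_left x y := by
    obtain ⟨hx, hSDx⟩ := hR.2 x
    obtain ⟨hy, hSDy⟩ := hR.2 y
    have h := isFormalAdjoint_self_of_isSelfAdjoint hSD ⟨R x, hx⟩ ⟨R y, hy⟩
    rw [hSDx, hSDy] at h
    exact h.symm
  mem_adjoint_graph y := by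
    obtain ⟨hy, hSDy⟩ := hR.2 y
    have h := mem_graph_of_le (le_adjoint_of_le_isSelfAdjoint hS hSD hSSD) ⟨R y, hy⟩
    rwa [hSDy] at h

namespace IsSymmetricRightInverse

theorem apply_apply (hR : IsSymmetricRightInverse S R) (hS : Dense (S.domain : Set H))
    (f : S.domain) : R (S f) = f := by
  refine ext_inner_right ℂ fun y => ?_
  rw [hR.inner_apply_left, (mem_adjoint_graph_iff hS).1 (hR.mem_adjoint_graph y)]

theorem le_adjoint (hR : IsSymmetricRightInverse S R) (hS : Dense (S.domain : Set H)) :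
    S ≤ S† := by
  refine LinearPMap.IsFormalAdjoint.le_adjoint hS fun f g => ?_
  rw [← hR.apply_apply hS g, ← hR.inner_apply_left, hR.apply_apply hS f]

theorem isClosable (hR : IsSymmetricRightInverse S R) (hS : Dense (S.domain : Set H)) :
    S.IsClosable :=
  (LinearPMap.adjoint_isClosed hS).isClosable.leIsClosable (hR.le_adjoint hS)

theorem closure_graph_le (hR : IsSymmetricRightInverse S R) (hS : Dense (S.domain : Set H)) :
    S.closure.graph ≤ S†.graph :=
  LinearPMap.le_graph_of_le
    (closure_le_of_isClosed (LinearPMap.adjoint_isClosed hS) (hR.le_adjoint hS))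

theorem apply_closure (hR : IsSymmetricRightInverse S R) (hS : Dense (S.domain : Set H))
    (f : S.closure.domain) : R (S.closure f) = f := by
  refine ext_inner_right ℂ fun y => ?_
  rw [hR.inner_apply_left, inner_closure_left hS (hR.isClosable hS) (hR.mem_adjoint_graph y)]

theorem isRegularTypePoint_closure (hR : IsSymmetricRightInverse S R)
    (hS : Dense (S.domain : Set H)) : IsRegularTypePoint S.closure 0 := by
  refine ⟨(‖R‖ + 1)⁻¹, by positivity, fun f => ?_⟩
  rw [zero_smul, sub_zero, inv_mul_le_iff₀ (by positivity)]
  calc ‖(f : H)‖ = ‖R (S.closure f)‖ := by rw [hR.apply_closure hS]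
    _ ≤ ‖R‖ * ‖S.closure f‖ := R.le_opNorm _
    _ ≤ (‖R‖ + 1) * ‖S.closure f‖ := by gcongr; exact le_add_of_nonneg_right zero_le_one

theorem sub_apply_mem_deficiencySpace (hR : IsSymmetricRightInverse S R) {x y : H}
    (hxy : (x, y) ∈ S†.graph) : x - R y ∈ deficiencySpace S 0 := by
  rw [mem_deficiencySpace_zero]
  simpa using S†.graph.sub_mem hxy (hR.mem_adjoint_graph y)

end IsSymmetricRightInverse

/-- The linear relation in `ker S†` formed by the boundary values of a subspace `G` of the graph
of `S†`. -/
noncomputable def boundaryRelation (S : H →ₗ.[ℂ] H) (R : H →L[ℂ] H) (G : Submodule ℂ (H × H)) :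
    Submodule ℂ (H × H) :=
  (deficiencySpace S 0).prod (deficiencySpace S 0) ⊓ G.comap (boundaryLift R)

theorem coe_extensionGraph_toRelation :
    (extensionGraph S R (toRelation (deficiencySpace S 0) T) : Set (H × H)) =
      relativeGraph S R T := by
  ext ⟨x, y⟩
  rw [SetLike.mem_coe, mem_extensionGraph]
  constructor
  · rintro ⟨f, v, n, hvn, rfl, rfl⟩
    obtain ⟨u, w, hw, ⟨⟩⟩ := mem_toRelation.1 hvn
    exact ⟨f, u, ⟨w, hw⟩, rfl, (add_assoc _ _ _).symm⟩
  · rintro ⟨f, u, w, hx, hy⟩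
    exact ⟨f, u, T u + w, mem_toRelation.2 ⟨u, w, w.2, rfl⟩, hx, hy.trans (add_assoc _ _ _)⟩

theorem IsSymmetricRightInverse.extensionGraph_prod (hR : IsSymmetricRightInverse S R)
    (hS : Dense (S.domain : Set H)) :
    extensionGraph S R ((deficiencySpace S 0).prod (deficiencySpace S 0)) = S†.graph := by
  refine le_antisymm (sup_le (hR.closure_graph_le hS) ?_) ?_
  · rintro _ ⟨⟨v, n⟩, ⟨hv, -⟩, rfl⟩
    simpa [boundaryLift_apply] using
      S†.graph.add_mem (hR.mem_adjoint_graph n) (mem_deficiencySpace_zero.1 hv)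
  · rintro ⟨x, y⟩ hxy
    obtain ⟨f, n, rfl⟩ := exists_closure_sub_smul_add (z := 0) hS (hR.isClosable hS)
      (by simpa using hR.isRegularTypePoint_closure hS) y
    rw [map_zero, zero_smul, sub_zero] at hxy ⊢
    refine mem_extensionGraph.2 ⟨f, x - R (S.closure f + n), n,
      ⟨hR.sub_apply_mem_deficiencySpace hxy, n.2⟩, ?_, rfl⟩
    rw [map_add, hR.apply_closure hS]
    abel

theorem IsSymmetricRightInverse.disjoint_closure_graph (hR : IsSymmetricRightInverse S R)
    (hS : Dense (S.domain : Set H)) :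
    Disjoint S.closure.graph
      (((deficiencySpace S 0).prod (deficiencySpace S 0)).map (boundaryLift R)) := by
  rw [Submodule.disjoint_def]
  rintro _ hf ⟨⟨v, n⟩, ⟨-, hn⟩, rfl⟩
  obtain ⟨f, hf_fst, hf_snd⟩ := S.closure.mem_graph_iff.1 hf
  have hfn : S.closure f = n := hf_snd
  have hn_zero : n = 0 := by
    rw [← Submodule.mem_bot (R := ℂ), ← (deficiencySpace S 0).inf_orthogonal_eq_bot]
    exact ⟨hn, hfn ▸ closure_apply_mem_orthogonal hS (hR.isClosable hS) f⟩
  have hf_zero : (f : H) = 0 := by rw [← hR.apply_closure hS f, hfn, hn_zero, map_zero]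
  exact Prod.ext (hf_fst.symm.trans hf_zero) hn_zero

theorem IsSymmetricRightInverse.extensionGraph_boundaryRelation
    (hR : IsSymmetricRightInverse S R) (hS : Dense (S.domain : Set H)) {G : Submodule ℂ (H × H)}
    (hSG : S.closure.graph ≤ G) (hG : G ≤ S†.graph) :
    extensionGraph S R (boundaryRelation S R G) = G := by
  rw [extensionGraph, boundaryRelation, ← Submodule.map_inf_eq_map_inf_comap,
    ← sup_inf_assoc_of_le _ hSG, ← extensionGraph, hR.extensionGraph_prod hS, inf_eq_right]
  exact hG

theorem IsSymmetricRightInverse.boundaryRelation_extensionGraph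
    (hR : IsSymmetricRightInverse S R) (hS : Dense (S.domain : Set H)) {L : Submodule ℂ (H × H)}
    (hL : L ≤ (deficiencySpace S 0).prod (deficiencySpace S 0)) :
    boundaryRelation S R (extensionGraph S R L) = L := by
  apply Submodule.map_injective_of_injective (boundaryLift_injective (R := R))
  rw [boundaryRelation, extensionGraph, ← Submodule.map_inf_eq_map_inf_comap, inf_comm, sup_comm,
    sup_inf_assoc_of_le _ (Submodule.map_mono hL), (hR.disjoint_closure_graph hS).eq_bot,
    sup_bot_eq]

theorem IsSymmetricRightInverse.boundaryRelation_adjoint (hR : IsSymmetricRightInverse S R)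
    (hS : Dense (S.domain : Set H)) {G : Submodule ℂ (H × H)} (hSG : S.closure.graph ≤ G)
    (hG : G ≤ S†.graph) :
    boundaryRelation S R G.adjoint =
      (boundaryRelation S R G).adjoint ⊓ (deficiencySpace S 0).prod (deficiencySpace S 0) := by
  have green (a b v n : H) : inner ℂ n (R b + a) - inner ℂ (R n + v) b =
      inner ℂ n a - inner ℂ v b := by
    rw [inner_add_right, inner_add_left, hR.inner_apply_left, add_sub_add_left_eq_sub]
  ext ⟨a, b⟩
  rw [boundaryRelation, inf_comm, Submodule.mem_inf, Submodule.mem_inf, Submodule.mem_comap,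
    boundaryLift_apply, Submodule.mem_adjoint_iff, Submodule.mem_adjoint_iff]
  refine and_congr_left fun hab => ⟨fun h v n hvn => ?_, fun h x y hxy => ?_⟩
  · rw [← green]
    exact h _ _ hvn.2
  · rw [← hR.extensionGraph_boundaryRelation hS hSG hG] at hxy
    obtain ⟨f, v, n, hvn, rfl, rfl⟩ := mem_extensionGraph.1 hxy
    have hlift : (R b + a, b) ∈ S†.graph := by
      rw [← hR.extensionGraph_prod hS]
      exact Submodule.mem_sup_right ⟨(a, b), hab, rfl⟩
    rw [add_assoc, inner_add_left, inner_add_left (f : H),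
      inner_closure_left hS (hR.isClosable hS) hlift, add_sub_add_left_eq_sub, green]
    exact h _ _ hvn

theorem IsSymmetricRightInverse.isSelfAdjointRelation_boundaryRelation
    (hR : IsSymmetricRightInverse S R) (hS : Dense (S.domain : Set H)) (hA : IsSelfAdjoint A)
    (hSA : S ≤ A) :
    IsSelfAdjointRelation (deficiencySpace S 0) (boundaryRelation S R A.graph) := by
  have h := hR.boundaryRelation_adjoint hS
    (LinearPMap.le_graph_of_le (closure_le_of_isClosed hA.isClosed hSA))
    (LinearPMap.le_graph_of_le (le_adjoint_of_le_isSelfAdjoint hS hA hSA))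
  rw [adjoint_graph_of_isSelfAdjoint hA] at h
  exact h.symm

theorem IsSymmetricRightInverse.isRelativeParameter_iff (hR : IsSymmetricRightInverse S R)
    (hS : Dense (S.domain : Set H)) (hA : IsSelfAdjoint A) (hSA : S ≤ A) :
    IsRelativeParameter S A R T ↔ IsSelfAdjointInSubspace (deficiencySpace S 0) T ∧
      toRelation (deficiencySpace S 0) T = boundaryRelation S R A.graph := by
  rw [IsRelativeParameter, ← coe_extensionGraph_toRelation, SetLike.coe_set_eq]
  refine and_congr_right fun hT => ⟨fun h => ?_, fun h => ?_⟩
  · rw [h, hR.boundaryRelation_extensionGraph hS hT.toRelation_le]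
  · rw [h, hR.extensionGraph_boundaryRelation hS
      (LinearPMap.le_graph_of_le (closure_le_of_isClosed hA.isClosed hSA))
      (LinearPMap.le_graph_of_le (le_adjoint_of_le_isSelfAdjoint hS hA hSA))]

theorem IsSymmetricRightInverse.existsUnique_isRelativeParameter
    (hR : IsSymmetricRightInverse S R) (hS : Dense (S.domain : Set H)) (hA : IsSelfAdjoint A)
    (hSA : S ≤ A) : ∃! T, IsRelativeParameter S A R T := by
  simp only [hR.isRelativeParameter_iff hS hA hSA]
  obtain ⟨T, hT, hTA⟩ := (hR.isSelfAdjointRelation_boundaryRelation hS hA hSA).exists_toRelation_eq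
    (isClosed_deficiencySpace hS 0)
  exact ⟨T, ⟨hT, hTA⟩, fun T' ⟨hT', hTA'⟩ => hT'.eq_of_toRelation_eq hT (hTA'.trans hTA.symm)⟩

namespace IsRelativeParameter

variable {g : A.domain} {f : S.closure.domain} {u : T.domain} {w : coDomainSpace S T}

theorem add_mem_deficiencySpace (hT : IsRelativeParameter S A R T) (u : T.domain)
    (w : coDomainSpace S T) : T u + w ∈ deficiencySpace S 0 :=
  (hT.1.toRelation_le (mem_toRelation.2 ⟨u, w, w.2, rfl⟩)).2

theorem mk_mem_graph (hT : IsRelativeParameter S A R T) (u : T.domain) (w : coDomainSpace S T) :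
    (R (T u + w) + u, T u + w) ∈ A.graph := by
  rw [← SetLike.mem_coe, hT.2]
  exact ⟨0, u, w, by simp, by simp [LinearPMap.map_zero]⟩

theorem apply_eq (hT : IsRelativeParameter S A R T) (hg : (f : H) + R (T u + w) + u = g) :
    A g = S.closure f + (T u + w) := by
  have hmem : ((g : H), S.closure f + (T u + w)) ∈ (A.graph : Set (H × H)) := by
    rw [hT.2]
    exact ⟨f, u, w, hg.symm, (add_assoc _ _ _).symm⟩
  exact apply_eq_of_mem_graph hmem g.2

theorem deficiencyProj_apply (hT : IsRelativeParameter S A R T)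
    (hR : IsSymmetricRightInverse S R) (hS : Dense (S.domain : Set H))
    (hg : (f : H) + R (T u + w) + u = g) : deficiencyProj hS 0 (A g) = T u + w := by
  simpa [hT.apply_eq hg] using deficiencyProj_closure_sub_smul_add hS (hR.isClosable hS) 0 f
    (hT.add_mem_deficiencySpace u w)

theorem coe_eq_sub_apply (hT : IsRelativeParameter S A R T) (hR : IsSymmetricRightInverse S R)
    (hS : Dense (S.domain : Set H)) (hg : (f : H) + R (T u + w) + u = g) :
    (u : H) = g - R (A g) := by
  rw [hT.apply_eq hg, map_add, hR.apply_closure hS, ← hg]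
  abel

theorem coe_eq_apply_sub_deficiencyProj (hT : IsRelativeParameter S A R T)
    (hR : IsSymmetricRightInverse S R) (hS : Dense (S.domain : Set H))
    (hg : (f : H) + R (T u + w) + u = g) : (f : H) = R (A g - deficiencyProj hS 0 (A g)) := by
  rw [hT.deficiencyProj_apply hR hS hg, hT.apply_eq hg, add_sub_cancel_right, hR.apply_closure hS]

theorem existsUnique_components (hT : IsRelativeParameter S A R T)
    (hR : IsSymmetricRightInverse S R) (hS : Dense (S.domain : Set H)) (g : A.domain) :
    ∃! p : S.closure.domain × T.domain × coDomainSpace S T,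
      (p.1 : H) + R (T p.2.1 + p.2.2) + p.2.1 = g := by
  have hmem : ((g : H), A g) ∈ relativeGraph S R T := hT.2 ▸ A.mem_graph g
  obtain ⟨f, u, w, hg, -⟩ := hmem
  refine ⟨(f, u, w), hg.symm, ?_⟩
  rintro ⟨f', u', w'⟩ hg'
  obtain rfl : u' = u := Subtype.ext <|
    (hT.coe_eq_sub_apply hR hS hg').trans (hT.coe_eq_sub_apply hR hS hg.symm).symm
  obtain rfl : f' = f := Subtype.ext <| (hT.coe_eq_apply_sub_deficiencyProj hR hS hg').trans
    (hT.coe_eq_apply_sub_deficiencyProj hR hS hg.symm).symm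
  obtain rfl : w' = w := Subtype.ext <| add_left_cancel <|
    (hT.deficiencyProj_apply hR hS hg').symm.trans (hT.deficiencyProj_apply hR hS hg.symm)
  rfl

end IsRelativeParameter

end RelativeParameter

section Limits

theorem tendsto_coe_towardsZero :
    Tendsto (fun ε : Set.Ioi (0 : ℝ) => (ε : ℝ)) towardsZero (𝓝 0) :=
  tendsto_comap.mono_right nhdsWithin_le_nhds

variable {E : Type*} [NormedAddCommGroup E] {x x' : Set.Ioi (0 : ℝ) → E} {y y' : E}

theorem EqAddBigO.of_norm_sub_le_sq {C : ℝ} (h : ∀ ε, ‖x ε - y‖ ≤ C * (ε : ℝ) ^ 2) :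
    EqAddBigO x y := by
  have hsq : (fun ε : Set.Ioi (0 : ℝ) => (ε : ℝ) ^ 2) =O[towardsZero] fun ε => (ε : ℝ) := by
    simpa [sq] using (isBigO_refl (fun ε : Set.Ioi (0 : ℝ) => (ε : ℝ)) towardsZero).mul
      (tendsto_coe_towardsZero.isBigO_one ℝ)
  exact (IsBigO.of_bound C (.of_forall fun ε => by simpa using h ε)).trans hsq

theorem EqAddBigO.of_eq (h : ∀ ε, x ε = y) : EqAddBigO x y :=
  .of_norm_sub_le_sq (C := 0) fun _ => by simp [h]

theorem EqAddBigO.const_sub (h : EqAddBigO x y) (c : E) :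
    EqAddBigO (fun ε => c - x ε) (c - y) :=
  h.neg_left.congr_left fun ε => by simp only [neg_sub, sub_sub_sub_cancel_left]

variable [NormedSpace ℂ E]

theorem EqAddBigO.map (h : EqAddBigO x y) (L : E →L[ℂ] E) :
    EqAddBigO (fun ε => L (x ε)) (L y) :=
  ((L.isBigO_comp _ _).trans h).congr_left fun _ => map_sub L _ _

theorem EqAddBigO.add_mul_smul (h : EqAddBigO x y) (h' : EqAddBigO x' y') (z : ℂ) :
    EqAddBigO (fun ε => x ε + (z * (ε : ℝ)) • x' ε) y := by
  have hx' : x' =O[towardsZero] fun _ => (1 : ℝ) := by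
    simpa using (IsBigO.trans h' (tendsto_coe_towardsZero.isBigO_one ℝ)).add
      (isBigO_const_const y' one_ne_zero towardsZero)
  have hz : (fun ε : Set.Ioi (0 : ℝ) => z * ((ε : ℝ) : ℂ)) =O[towardsZero] fun ε => (ε : ℝ) :=
    .of_bound ‖z‖ (.of_forall fun _ => by simp)
  have hzx' : (fun ε : Set.Ioi (0 : ℝ) => (z * (ε : ℝ)) • x' ε) =O[towardsZero]
      fun ε => (ε : ℝ) := by
    simpa using hz.smul hx'
  exact (IsBigO.add h hzx').congr_left fun _ => (add_sub_right_comm _ _ _).symm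

variable {H : Type*} [NormedAddCommGroup H] [InnerProductSpace ℂ H] {A : H →ₗ.[ℂ] H}
  {a a' : Set.Ioi (0 : ℝ) → H} {b b' : H}

theorem EqAddBigOGraph.of_mem_graph (h : EqAddBigO a b) (h' : EqAddBigO a' b')
    (ha : ∀ ε, (a ε, a' ε) ∈ A.graph) (hb : (b, b') ∈ A.graph) : EqAddBigOGraph A a b := by
  refine ⟨fun ε => LinearPMap.mem_domain_of_mem_graph (ha ε),
    LinearPMap.mem_domain_of_mem_graph hb, ?_⟩
  refine IsBigO.trans (.of_bound 1 (.of_forall fun ε => ?_)) (h.norm_left.add h'.norm_left)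
  have hnorm : 0 ≤ ‖a ε - b‖ + ‖a' ε - b'‖ := by positivity
  rw [graphNorm, LinearPMap.map_sub, apply_eq_of_mem_graph (ha ε), apply_eq_of_mem_graph hb,
    one_mul, Real.norm_of_nonneg (Real.sqrt_nonneg _), Real.norm_of_nonneg hnorm]
  refine Real.sqrt_le_iff.2 ⟨hnorm, ?_⟩
  rw [add_sq]
  change ‖a ε - b‖ ^ 2 + _ ≤ _
  linarith [mul_nonneg (norm_nonneg (a ε - b)) (norm_nonneg (a' ε - b'))]

theorem EqAddBigOGraph.of_le {B : H →ₗ.[ℂ] H} (h : EqAddBigOGraph A a b) (hAB : A ≤ B) :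
    EqAddBigOGraph B a b := by
  obtain ⟨ha, hb, hO⟩ := h
  refine ⟨fun ε => hAB.1 (ha ε), hAB.1 hb, hO.congr_left fun ε => ?_⟩
  have hap (x : A.domain) : B ⟨x, hAB.1 x.2⟩ = A x := (hAB.2 rfl).symm
  rw [graphNorm, graphNorm, ← hap]
  rfl

end Limits

section Comparison

variable {H : Type*} [NormedAddCommGroup H] [InnerProductSpace ℂ H] [CompleteSpace H]
  {S A T : H →ₗ.[ℂ] H} {R : H →L[ℂ] H} {ε : ℝ}
  {U : deficiencySpace S (Complex.I * ε) ≃ₗᵢ[ℂ] deficiencySpace S (-(Complex.I * ε))}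
  {g : A.domain} {f f' : S.closure.domain} {u : T.domain} {w : coDomainSpace S T}
  {v : deficiencySpace S (Complex.I * ε)}

theorem IsVonNeumannParameter.apply_sub_closure_mem_adjoint_graph
    (hU : IsVonNeumannParameter S A ε U) (hg : (g : H) = f + v - U v) :
    (A g - S.closure f, (Complex.I * ε) ^ 2 • ((g : H) - f)) ∈ S†.graph := by
  have hv := S†.graph.smul_mem (Complex.I * ε) (mem_deficiencySpace.1 v.2)
  have hUv := S†.graph.smul_mem (Complex.I * ε) (mem_deficiencySpace.1 (U v).2)
  convert S†.graph.add_mem hv hUv using 1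
  refine Prod.ext ?_ ?_
  · rw [hU.apply_eq hg]
    simp only [Prod.smul_mk, Prod.mk_add_mk]
    abel
  · rw [hg]
    simp only [Prod.smul_mk, Prod.mk_add_mk]
    module

theorem IsVonNeumannParameter.sub_sub_apply_adjoint (hU : IsVonNeumannParameter S A ε U)
    (hR : IsSymmetricRightInverse S R) (hS : Dense (S.domain : Set H))
    (hg : (g : H) = f + v - U v) :
    (v : H) - U v - R (S† (toAdjointDomain S _ v - toAdjointDomain S _ (U v))) =
      g - R (A g) := by
  rw [LinearPMap.map_sub, adjoint_toAdjointDomain, adjoint_toAdjointDomain, neg_smul,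
    sub_neg_eq_add, hU.apply_eq hg, add_assoc, map_add R (S.closure f), hR.apply_closure hS, hg]
  abel

theorem IsSymmetricRightInverse.norm_closure_le (hR : IsSymmetricRightInverse S R)
    (hS : Dense (S.domain : Set H)) {h : S.closure.domain} {t : ℝ} {y : H}
    (hh : (S.closure h, (t ^ 2 : ℂ) • (y - h)) ∈ S†.graph) :
    ‖S.closure h‖ ≤ ‖R‖ * ‖y‖ * t ^ 2 := by
  have hinner := inner_closure_left hS (hR.isClosable hS) hh h
  have hre : ‖S.closure h‖ ^ 2 = t ^ 2 * ((inner ℂ (h : H) y).re - ‖(h : H)‖ ^ 2) := by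
    rw [inner_smul_right, inner_sub_right, inner_self_eq_norm_sq_to_K,
      inner_self_eq_norm_sq_to_K] at hinner
    simpa [← Complex.ofReal_pow, Complex.re_ofReal_mul] using congrArg Complex.re hinner
  have hh_norm : ‖(h : H)‖ ≤ ‖R‖ * ‖S.closure h‖ := by
    simpa [hR.apply_closure hS] using R.le_opNorm (S.closure h)
  have hmul : ‖S.closure h‖ * ‖S.closure h‖ ≤ ‖R‖ * ‖y‖ * t ^ 2 * ‖S.closure h‖ :=
    calc ‖S.closure h‖ * ‖S.closure h‖
        = t ^ 2 * ((inner ℂ (h : H) y).re - ‖(h : H)‖ ^ 2) := by rw [← sq, hre]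
      _ ≤ t ^ 2 * (‖(h : H)‖ * ‖y‖) := by
        gcongr
        exact (sub_le_self _ (sq_nonneg _)).trans (re_inner_le_norm (𝕜 := ℂ) _ _)
      _ ≤ t ^ 2 * (‖R‖ * ‖S.closure h‖ * ‖y‖) := by gcongr
      _ = ‖R‖ * ‖y‖ * t ^ 2 * ‖S.closure h‖ := by ring
  rcases (norm_nonneg (S.closure h)).eq_or_lt with hzero | hpos
  · rw [← hzero]
    positivity
  · exact le_of_mul_le_mul_right hmul hpos

theorem IsRelativeParameter.norm_closure_sub_le (hT : IsRelativeParameter S A R T)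
    (hR : IsSymmetricRightInverse S R) (hS : Dense (S.domain : Set H))
    (hg : (f : H) + R (T u + w) + u = g) (hU : IsVonNeumannParameter S A ε U)
    (hg' : (g : H) = f' + v - U v) :
    ‖S.closure f' - S.closure f‖ ≤ ‖R‖ * ‖(g : H) - f‖ * ε ^ 2 := by
  have hmem := S†.graph.sub_mem (mem_deficiencySpace_zero.1 (hT.add_mem_deficiencySpace u w))
    (hU.apply_sub_closure_mem_adjoint_graph hg')
  rw [← LinearPMap.map_sub]
  refine hR.norm_closure_le hS ?_
  convert hmem using 1
  refine Prod.ext ?_ ?_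
  · rw [LinearPMap.map_sub, hT.apply_eq hg]
    simp only [Prod.mk_sub_mk]
    abel
  · simp [mul_pow]

end Comparison

section ComponentLimits

variable {H : Type*} [NormedAddCommGroup H] [InnerProductSpace ℂ H] [CompleteSpace H]
  {S A T : H →ₗ.[ℂ] H} {R : H →L[ℂ] H}
  {U : ∀ ε : Set.Ioi (0 : ℝ), deficiencySpace S (Complex.I * (ε : ℝ)) ≃ₗᵢ[ℂ]
    deficiencySpace S (-(Complex.I * (ε : ℝ)))}
  {g : A.domain} {f : S.closure.domain} {u : T.domain} {w : coDomainSpace S T}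
  {fe : Set.Ioi (0 : ℝ) → S.closure.domain}
  {ue : ∀ ε : Set.Ioi (0 : ℝ), deficiencySpace S (Complex.I * (ε : ℝ))}

namespace IsRelativeParameter

variable (hT : IsRelativeParameter S A R T) (hR : IsSymmetricRightInverse S R)
  (hS : Dense (S.domain : Set H)) (hg : (f : H) + R (T u + w) + u = g)
  (hU : ∀ ε, IsVonNeumannParameter S A _ (U ε)) (hge : ∀ ε, (g : H) = fe ε + ue ε - U ε (ue ε))

include hT hR hS hg hU hge

theorem eqAddBigO_closure_apply :
    EqAddBigO (fun ε => S.closure (fe ε)) (S.closure f) :=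
  .of_norm_sub_le_sq fun ε => hT.norm_closure_sub_le hR hS hg (hU ε) (hge ε)

theorem eqAddBigO_coe :
    EqAddBigO (fun ε => (fe ε : H)) (f : H) := by
  simpa only [hR.apply_closure hS] using (hT.eqAddBigO_closure_apply hR hS hg hU hge).map R

theorem eqAddBigO_sub :
    EqAddBigO (fun ε => (ue ε : H) - U ε (ue ε)) (R (T u + w) + u) := by
  have hdiff (ε) : (ue ε : H) - U ε (ue ε) = g - fe ε := by rw [hge ε]; abel
  have hlim : R (T u + w) + u = g - f := by rw [← hg]; abel
  simp only [hdiff, hlim]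
  exact (hT.eqAddBigO_coe hR hS hg hU hge).const_sub g

theorem eqAddBigO_smul_add_smul :
    EqAddBigO (fun ε => (Complex.I * (ε : ℝ)) • (ue ε : H) +
      (Complex.I * (ε : ℝ)) • (U ε (ue ε) : H)) (T u + w) := by
  have hsum (ε : Set.Ioi (0 : ℝ)) : (Complex.I * (ε : ℝ)) • (ue ε : H) +
      (Complex.I * (ε : ℝ)) • (U ε (ue ε) : H) = A g - S.closure (fe ε) := by
    rw [(hU ε).apply_eq (hge ε)]
    abel
  have hlim : T u + w = A g - S.closure f := by rw [hT.apply_eq hg, add_sub_cancel_left]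
  simp only [hsum, hlim]
  exact (hT.eqAddBigO_closure_apply hR hS hg hU hge).const_sub (A g)

theorem eqAddBigO_two_mul_smul :
    EqAddBigO (fun ε => (2 * Complex.I * (ε : ℝ)) • (ue ε : H)) (T u + w) := by
  convert (hT.eqAddBigO_smul_add_smul hR hS hg hU hge).add_mul_smul
    (hT.eqAddBigO_sub hR hS hg hU hge) Complex.I using 2
  module

theorem eqAddBigO_two_mul_smul_apply :
    EqAddBigO (fun ε => (2 * Complex.I * (ε : ℝ)) • (U ε (ue ε) : H)) (T u + w) := by
  convert (hT.eqAddBigO_smul_add_smul hR hS hg hU hge).add_mul_smul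
    (hT.eqAddBigO_sub hR hS hg hU hge) (-Complex.I) using 2
  module

theorem eqAddBigOGraph_sub :
    EqAddBigOGraph A (fun ε => (ue ε : H) - U ε (ue ε)) (R (T u + w) + u) :=
  .of_mem_graph (hT.eqAddBigO_sub hR hS hg hU hge) (hT.eqAddBigO_smul_add_smul hR hS hg hU hge)
    (fun ε => (hU ε).mk_mem_graph (ue ε)) (hT.mk_mem_graph u w)

theorem eqAddBigOGraph_coe (hSA : S.closure ≤ A) :
    EqAddBigOGraph A (fun ε => (fe ε : H)) (f : H) :=
  .of_mem_graph (hT.eqAddBigO_coe hR hS hg hU hge)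
    (hT.eqAddBigO_closure_apply hR hS hg hU hge) (fun ε => mem_graph_of_le hSA (fe ε))
    (mem_graph_of_le hSA f)

end IsRelativeParameter

end ComponentLimits

end ExtensionTheory

open ExtensionTheory in
theorem mainTheorem3 {H : Type*} [NormedAddCommGroup H] [InnerProductSpace ℂ H] [CompleteSpace H]
    (S : H →ₗ.[ℂ] H) (hdense : Dense (S.domain : Set H)) (hsymm : S.IsFormalAdjoint S)
    (hreg : IsRegularTypePoint S.closure 0) (hdef : deficiencySpace S 0 ≠ ⊥)
    -- the distinguished extension and its inverse
    (SD : H →ₗ.[ℂ] H) (hSD : IsSelfAdjoint SD) (hSSD : S ≤ SD)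
    (R : H →L[ℂ] H) (hR : IsBoundedInverse SD R)
    -- the self-adjoint extension under consideration
    (A : H →ₗ.[ℂ] H) (hA : IsSelfAdjoint A) (hSA : S ≤ A) :
    -- the extension parameters are well defined
    (∀ ε : Set.Ioi (0 : ℝ), ∃! U, IsVonNeumannParameter S A (ε : ℝ) U) ∧
    (∃! T, IsRelativeParameter S A R T) ∧
    ∀ (U : ∀ ε : Set.Ioi (0 : ℝ), deficiencySpace S (Complex.I * (ε : ℝ)) ≃ₗᵢ[ℂ]
          deficiencySpace S (-(Complex.I * (ε : ℝ))))
      (_ : ∀ ε : Set.Ioi (0 : ℝ), IsVonNeumannParameter S A (ε : ℝ) (U ε))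
      (T : H →ₗ.[ℂ] H) (_ : IsRelativeParameter S A R T) (g : A.domain),
      -- the components of `g` exist and are uniquely determined
      (∃! p : S.closure.domain × T.domain × coDomainSpace S T,
        (p.1 : H) + R (T p.2.1 + p.2.2) + p.2.1 = g) ∧
      (∀ ε : Set.Ioi (0 : ℝ),
        ∃! p : S.closure.domain × deficiencySpace S (Complex.I * (ε : ℝ)),
          (g : H) = p.1 + p.2 - U ε p.2) ∧
      ∀ (f : S.closure.domain) (u : T.domain) (w : coDomainSpace S T)
        (_ : (f : H) + R (T u + w) + u = g)
        (fe : Set.Ioi (0 : ℝ) → S.closure.domain)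
        (ue : ∀ ε : Set.Ioi (0 : ℝ), deficiencySpace S (Complex.I * (ε : ℝ)))
        (_ : ∀ ε, (g : H) = fe ε + ue ε - U ε (ue ε)),
        -- explicit formulas for the components
        (∀ ε : Set.Ioi (0 : ℝ), (ue ε : H) = (2 * Complex.I * (ε : ℝ))⁻¹ •
          deficiencyProj hdense (Complex.I * (ε : ℝ)) (A g + (Complex.I * (ε : ℝ)) • (g : H))) ∧
        (∀ ε : Set.Ioi (0 : ℝ), (U ε (ue ε) : H) = (2 * Complex.I * (ε : ℝ))⁻¹ •
          deficiencyProj hdense (-(Complex.I * (ε : ℝ)))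
            (A g - (Complex.I * (ε : ℝ)) • (g : H))) ∧
        (u : H) = g - R (A g) ∧
        (f : H) = R (A g - deficiencyProj hdense 0 (A g)) ∧
        T u + w = deficiencyProj hdense 0 (A g) ∧
        -- limits in the norm of the Hilbert space
        EqAddBigO (fun ε => ((ue ε : H) - U ε (ue ε)) -
          R (S† (toAdjointDomain S _ (ue ε) - toAdjointDomain S _ (U ε (ue ε))))) (u : H) ∧
        EqAddBigO (fun ε => (2 * Complex.I * (ε : ℝ)) • (ue ε : H)) (T u + w) ∧
        EqAddBigO (fun ε => (2 * Complex.I * (ε : ℝ)) • (U ε (ue ε) : H)) (T u + w) ∧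
        EqAddBigO (fun ε => (ue ε : H) - U ε (ue ε)) (R (T u + w) + u) ∧
        EqAddBigO (fun ε => (Complex.I * (ε : ℝ)) • (ue ε : H) +
          (Complex.I * (ε : ℝ)) • (U ε (ue ε) : H)) (T u + w) ∧
        EqAddBigO (fun ε => (fe ε : H)) (f : H) ∧
        EqAddBigO (fun ε => S.closure (fe ε)) (S.closure f) ∧
        -- limits in the graph norms
        EqAddBigOGraph A (fun ε => (ue ε : H) - U ε (ue ε)) (R (T u + w) + u) ∧
        EqAddBigOGraph A (fun ε => (fe ε : H)) (f : H) ∧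
        EqAddBigOGraph S† (fun ε => (ue ε : H) - U ε (ue ε)) (R (T u + w) + u) ∧
        EqAddBigOGraph S† (fun ε => (fe ε : H)) (f : H) := by
  have hR := hR.isSymmetricRightInverse hdense hSD hSSD
  have hcl := hR.isClosable hdense
  have hε (ε : Set.Ioi (0 : ℝ)) : (ε : ℝ) ≠ 0 := (Set.mem_Ioi.1 ε.2).ne'
  refine ⟨fun ε => existsUnique_isVonNeumannParameter hdense hA hSA (hε ε),
    hR.existsUnique_isRelativeParameter hdense hA hSA, fun U hU T hT g =>
    ⟨hT.existsUnique_components hR hdense g, fun ε =>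
      (hU ε).existsUnique_components hdense hcl (hε ε) g, fun f u w hg fe ue hge => ?_⟩⟩
  have hAadj := le_adjoint_of_le_isSelfAdjoint hdense hA hSA
  have hgraph_sub := hT.eqAddBigOGraph_sub hR hdense hg hU hge
  have hgraph_coe := hT.eqAddBigOGraph_coe hR hdense hg hU hge
    (closure_le_of_isClosed hA.isClosed hSA)
  exact ⟨fun ε => (hU ε).coe_eq_smul_deficiencyProj hdense hcl (hε ε) (hge ε),
    fun ε => (hU ε).coe_apply_eq_smul_deficiencyProj hdense hcl (hε ε) (hge ε),
    hT.coe_eq_sub_apply hR hdense hg, hT.coe_eq_apply_sub_deficiencyProj hR hdense hg,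
    (hT.deficiencyProj_apply hR hdense hg).symm,
    .of_eq fun ε => ((hU ε).sub_sub_apply_adjoint hR hdense (hge ε)).trans
      (hT.coe_eq_sub_apply hR hdense hg).symm,
    hT.eqAddBigO_two_mul_smul hR hdense hg hU hge,
    hT.eqAddBigO_two_mul_smul_apply hR hdense hg hU hge,
    hT.eqAddBigO_sub hR hdense hg hU hge, hT.eqAddBigO_smul_add_smul hR hdense hg hU hge,
    hT.eqAddBigO_coe hR hdense hg hU hge, hT.eqAddBigO_closure_apply hR hdense hg hU hge,
    hgraph_sub, hgraph_coe, hgraph_sub.of_le hAadj, hgraph_coe.of_le hAadj⟩
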